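/- Fix $P,\Delta f>0$ and $\varepsilon,\tau\ge 0$. For integers $N,B,L\ge 1$ and $a\ge 0$ let $\mathbf Y=\sqrt a\,\mathbf h\mathbf u^{H}+\mathbf Z\in\mathbb C^{N\times L}$, where $\mathbf u$ is uniformly distributed on the unit sphere of $\mathbb C^{L}$, $\mathbf h\in\mathbb C^{N}$ and $\mathbf Z\in\mathbb C^{N\times L}$ have i.i.d. $\mathcal{CN}(0,1)$ entries, and $\mathbf u,\mathbf h,\mathbf Z$ are independent. Let $I(\mathbf u;\mathbf Y\mid a)$ denote the mutual information of $\mathbf u$ and $\mathbf Y$ for this value of $a$, and define the shape-encoding capacity $$C_S(B,N,L)=\sup_{1\le M\le B}\ \sup_{p(a):\,a\ge 0,\ \mathbb E[a]\le PL/M}\ \frac{M\,\Delta f}{L}\ \mathbb E_{a\sim p}\big[I(\mathbf u;\mathbf Y\mid a)\big].$$ Let $B=B(N)\ge1$ and $L=L(N)\ge1$ be integers depending on $N$, and put $x=\min\left(\varepsilon,\tfrac{1+\tau}{2},1\right)$. (1) If $\log B/\log N\to\varepsilon$ and $\log L/\log N\to\tau$ as $N\to\infty$, then $C_S(B,N,L)$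 has scaling exponent at most $x$: for every $\delta>0$, $C_S(B,N,L)\le N^{x+\delta}$ for all sufficiently large $N$. (2) If $B=\Theta(N^{\varepsilon})$ and $L=\Theta(N^{\tau})$ up to constant factors, then $C_S(B,N,L)=O(N^{x}\log N)$; and if moreover $\varepsilon\ge\min\left(\tfrac{1+\tau}{2},1\right)$, then $C_S(B,N,L)=O(N^{x})$. -/

import Mathlib

open MeasureTheory ProbabilityTheory Filter Asymptotics
open scoped ENNReal NNReal Topology

noncomputable section

namespace ShapeEncoding

/-- The law `𝒞𝒩(0,1)`: real and imaginary parts are independent `𝒩(0,1/2)`. -/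
def complexGaussian : Measure ℂ :=
  ((gaussianReal 0 (1 / 2)).prod (gaussianReal 0 (1 / 2))).map
    Complex.measurableEquivRealProd.symm

/-- The unit sphere of `ℂ^L` (Euclidean norm). -/
abbrev UnitVec (L : ℕ) : Type :=
  Metric.sphere (0 : EuclideanSpace ℂ (Fin L)) 1

/-- The isotropic law on the unit sphere of `ℂ^L`: normalized surface measure. -/
def isotropic (L : ℕ) : Measure (UnitVec L) :=
  ((volume : Measure (EuclideanSpace ℂ (Fin L))).toSphere Set.univ)⁻¹ •
    (volume : Measure (EuclideanSpace ℂ (Fin L))).toSphere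

/-- The channel output `Y = h xᴴ + Z` for the input `x = √a u`. -/
def channelOutput {N L : ℕ} (a : ℝ≥0) (u : UnitVec L) (h : Fin N → ℂ)
    (Z : Fin N → Fin L → ℂ) : Fin N → Fin L → ℂ :=
  fun n l => h n * star ((Real.sqrt a : ℂ) * u.1 l) + Z n l

/-- The joint law of `(u, Y)` for a fixed energy `a`, where `u` is isotropic, the fading `h` and
the noise `Z` have i.i.d. `𝒞𝒩(0,1)` entries, and `u`, `h`, `Z` are independent. -/
def shapeOutputLaw (N L : ℕ) (a : ℝ≥0) : Measure (UnitVec L × (Fin N → Fin L → ℂ)) :=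
  ((isotropic L).prod
    ((Measure.pi fun _ : Fin N => complexGaussian).prod
      (Measure.pi fun _ : Fin N => Measure.pi fun _ : Fin L => complexGaussian))).map
    fun w => (w.1, channelOutput a w.1 w.2.1 w.2.2)

/-- Mutual information (in nats) of the two components of a pair with joint law `ρ`. -/
def mutualInfo {α β : Type*} [MeasurableSpace α] [MeasurableSpace β]
    (ρ : Measure (α × β)) : ℝ≥0∞ :=
  InformationTheory.klDiv ρ (ρ.fst.prod ρ.snd)

/-- The conditional mutual information `I(u; Y | a)`, averaged over an energy `a ∼ p` that is
independent of `u`, `h` and `Z`. -/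
def shapeInfo (N L : ℕ) (p : Measure ℝ≥0) : ℝ≥0∞ :=
  ∫⁻ a, mutualInfo (shapeOutputLaw N L a) ∂p

/-- The shape-encoding capacity: the supremum of `(M Δf / L) · I(u; Y | a)` over the number
`1 ≤ M ≤ B` of active subchannels and all laws `p` of the energy with mean at most `P L / M`. -/
def shapeCapacity (P Δf : ℝ) (B N L : ℕ) : ℝ≥0∞ :=
  ⨆ (M : ℕ) (_ : 1 ≤ M ∧ M ≤ B) (p : Measure ℝ≥0) (_ : IsProbabilityMeasure p)
    (_ : ∫⁻ a, (a : ℝ≥0∞) ∂p ≤ ENNReal.ofReal (P * L / M)),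
    ENNReal.ofReal (M * Δf / L) * shapeInfo N L p

/-- `f` has scaling exponent `s`: `log f(N) / log N → s`. -/
def HasExponent (f : ℕ → ℕ) (s : ℝ) : Prop :=
  Tendsto (fun N : ℕ => Real.log (f N) / Real.log N) atTop (𝓝 s)

/-- `F` has scaling exponent at most `s`: `limsup log F(N) / log N ≤ s`. -/
def ExponentAtMost (F : ℕ → ℝ≥0∞) (s : ℝ) : Prop :=
  ∀ δ : ℝ, 0 < δ → ∀ᶠ N : ℕ in atTop, F N ≤ ENNReal.ofReal ((N : ℝ) ^ (s + δ))

/-- `F(N) ≤ C g(N)` for all large `N`, with some constant `C`. -/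
def AtMostOrder (F : ℕ → ℝ≥0∞) (g : ℕ → ℝ) : Prop :=
  ∃ C : ℝ, ∀ᶠ N : ℕ in atTop, F N ≤ ENNReal.ofReal (C * g N)

end ShapeEncoding

end

/-!
Let `u'` be a second input, drawn from the input law conditioned on a neighbourhood of `u` of mass
at least `θ`, and let `Y` be the output for `u`. Replacing the law of `(u, u', Y)` by the one with
`u'` independent of `u` and `Y` the output for `u'` turns the marginal of `(u, Y)` into the product
of its marginals. The chain rule and the data processing inequality then bound the mutual
information by `-log θ` plus the largest divergence between outputs for two neighbouring inputs.

For the fading channel the rows of the output are i.i.d. Gaussian vectors, and the divergence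
between the outputs for `u` and `u'` is `N a² / (1 + a) · (1 - |⟨u, u'⟩|²)`, while a cap of radius
`r` has mass at least `(r / 4) ^ (2 L)`. No localization, the radius `1 / √N` and the radius
`√L / (a √N)` respectively give `I(u; Y) ≤ N a`, `I(u; Y) ≤ L log (16 N) + a` and
`I(u; Y) ≤ 8 √(N L) a`. Being affine in `a`, these bounds survive averaging over the energy.
-/

noncomputable section

namespace ShapeEncoding

open InformationTheory

section KLDivergence

variable {α β : Type*} [MeasurableSpace α] [MeasurableSpace β]

lemma klDiv_map_equiv (e : α ≃ᵐ β) (μ ν : Measure α) [IsFiniteMeasure μ] [IsFiniteMeasure ν] :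
    klDiv (μ.map e) (ν.map e) = klDiv μ ν := by
  refine le_antisymm (klDiv_map_le μ ν e.measurable) ?_
  simpa only [MeasurableEquiv.map_symm_map] using
    klDiv_map_le (μ.map e) (ν.map e) e.symm.measurable

lemma rnDeriv_compProd_right_of_ac [MeasurableSpace.CountableOrCountablyGenerated α β]
    {μ : Measure α} [IsFiniteMeasure μ] {κ η : Kernel α β} [IsFiniteKernel κ] [IsFiniteKernel η]
    (hac : ∀ᵐ a ∂μ, κ a ≪ η a) :
    (μ ⊗ₘ κ).rnDeriv (μ ⊗ₘ η) =ᵐ[μ ⊗ₘ η] fun p => κ.rnDeriv η p.1 p.2 := by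
  have hκ : κ =ᵐ[μ] η.withDensity (κ.rnDeriv η) :=
    hac.mono fun a ha => (Kernel.withDensity_rnDeriv_eq ha).symm
  rw [Measure.compProd_congr hκ, Measure.compProd_withDensity (Kernel.measurable_rnDeriv κ η)]
  exact Measure.rnDeriv_withDensity _ (Kernel.measurable_rnDeriv κ η)

lemma klDiv_compProd_eq_lintegral [MeasurableSpace.CountableOrCountablyGenerated α β]
    (μ : Measure α) [IsFiniteMeasure μ] (κ η : Kernel α β) [IsFiniteKernel κ] [IsFiniteKernel η] :
    klDiv (μ ⊗ₘ κ) (μ ⊗ₘ η) = ∫⁻ a, klDiv (κ a) (η a) ∂μ := by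
  by_cases hac : ∀ᵐ a ∂μ, κ a ≪ η a
  · rw [klDiv_eq_lintegral_klFun_of_ac (Measure.absolutelyContinuous_compProd_right_iff.2 hac),
      Measure.lintegral_compProd (by fun_prop)]
    refine lintegral_congr_ae ?_
    filter_upwards [hac, Measure.ae_ae_of_ae_compProd (rnDeriv_compProd_right_of_ac hac)]
      with a hac_a hjoint
    rw [klDiv_eq_lintegral_klFun_of_ac hac_a]
    refine lintegral_congr_ae ?_
    filter_upwards [hjoint, Kernel.rnDeriv_eq_rnDeriv_measure (κ := κ) (η := η) (a := a)]
      with b hb hfiber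
    rw [hb, hfiber]
  · have hmeas : MeasurableSet {a | ¬ κ a ≪ η a} :=
      (Kernel.measurableSet_absolutelyContinuous κ η).compl
    rw [klDiv_of_not_ac (mt Measure.absolutelyContinuous_compProd_right_iff.1 hac), eq_comm,
      eq_top_iff]
    calc ∞ = ∫⁻ _ in {a | ¬ κ a ≪ η a}, ∞ ∂μ := by
          rw [setLIntegral_const, ENNReal.top_mul (by rwa [ae_iff] at hac)]
      _ = ∫⁻ a in {a | ¬ κ a ≪ η a}, klDiv (κ a) (η a) ∂μ :=
          setLIntegral_congr_fun hmeas fun a ha => (klDiv_of_not_ac ha).symm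
      _ ≤ ∫⁻ a, klDiv (κ a) (η a) ∂μ := setLIntegral_le_lintegral _ _

lemma klDiv_prod (μ₁ ν₁ : Measure α) (μ₂ ν₂ : Measure β) [IsProbabilityMeasure μ₁]
    [IsFiniteMeasure ν₁] [IsProbabilityMeasure μ₂] [IsProbabilityMeasure ν₂] :
    klDiv (μ₁.prod μ₂) (ν₁.prod ν₂) = klDiv μ₁ ν₁ + klDiv μ₂ ν₂ := by
  have hswap : klDiv (μ₁.prod μ₂) (μ₁.prod ν₂) = klDiv μ₂ ν₂ := by
    rw [← klDiv_map_equiv MeasurableEquiv.prodComm]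
    change klDiv ((μ₁.prod μ₂).map Prod.swap) ((μ₁.prod ν₂).map Prod.swap) = _
    rw [Measure.prod_swap, Measure.prod_swap, ← Measure.compProd_const, ← Measure.compProd_const,
      klDiv_compProd_left]
  rw [← Measure.compProd_const, ← Measure.compProd_const, klDiv_compProd_eq_add,
    Measure.compProd_const, Measure.compProd_const, hswap]

lemma klDiv_pi {n : ℕ} {X : Fin n → Type*} [∀ i, MeasurableSpace (X i)] (μ ν : ∀ i, Measure (X i))
    [∀ i, IsProbabilityMeasure (μ i)] [∀ i, IsProbabilityMeasure (ν i)] :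
    klDiv (Measure.pi μ) (Measure.pi ν) = ∑ i, klDiv (μ i) (ν i) := by
  induction n with
  | zero =>
    rw [Measure.pi_of_empty μ, Measure.pi_of_empty ν, klDiv_self, Fin.sum_univ_zero]
  | succ n ih =>
    rw [← klDiv_map_equiv (MeasurableEquiv.piFinSuccAbove X 0),
      (measurePreserving_piFinSuccAbove μ 0).map_eq, (measurePreserving_piFinSuccAbove ν 0).map_eq,
      klDiv_prod, ih, Fin.sum_univ_succ]
    rfl

lemma klDiv_cond (μ : Measure α) [IsProbabilityMeasure μ] {S : Set α} (hS : MeasurableSet S)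
    (hμS : μ S ≠ 0) : klDiv μ[|S] μ = ENNReal.ofReal (-Real.log (μ.real S)) := by
  have := cond_isProbabilityMeasure hμS
  have hllr : llr μ[|S] μ =ᵐ[μ[|S]] fun _ => -Real.log (μ.real S) := by
    have hderiv : (μ[|S]).rnDeriv μ =ᵐ[μ] fun x => (μ S)⁻¹ * S.indicator 1 x := by
      filter_upwards [Measure.rnDeriv_smul_left_of_ne_top (μ.restrict S) μ
        (ENNReal.inv_ne_top.2 hμS), Measure.rnDeriv_restrict_self μ hS] with x hsmul hrestrict
      rw [ProbabilityTheory.cond, hsmul, Pi.smul_apply, hrestrict, smul_eq_mul]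
    filter_upwards [cond_absolutelyContinuous.ae_le hderiv, ae_cond_mem hS] with x hx hxS
    rw [llr, hx, Set.indicator_of_mem hxS, Pi.one_apply, mul_one, ENNReal.toReal_inv, Real.log_inv,
      measureReal_def]
  rw [klDiv_of_ac_of_integrable cond_absolutelyContinuous
    ((integrable_const _).congr hllr.symm), integral_congr_ae hllr]
  simp

lemma klDiv_withDensity_exp {μ : Measure α} [IsProbabilityMeasure μ] {f : α → ℝ}
    (hf : Measurable f)
    [IsProbabilityMeasure (μ.withDensity fun x => ENNReal.ofReal (Real.exp (f x)))]
    (hint : Integrable f (μ.withDensity fun x => ENNReal.ofReal (Real.exp (f x)))) :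
    klDiv (μ.withDensity fun x => ENNReal.ofReal (Real.exp (f x))) μ =
      ENNReal.ofReal (∫ x, f x ∂μ.withDensity fun x => ENNReal.ofReal (Real.exp (f x))) := by
  have hac := withDensity_absolutelyContinuous μ fun x => ENNReal.ofReal (Real.exp (f x))
  have hllr : llr (μ.withDensity fun x => ENNReal.ofReal (Real.exp (f x))) μ
      =ᵐ[μ.withDensity fun x => ENNReal.ofReal (Real.exp (f x))] f := by
    filter_upwards [hac.ae_le (Measure.rnDeriv_withDensity μ
      (f := fun x => ENNReal.ofReal (Real.exp (f x))) (by fun_prop))] with x hx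
    rw [llr, hx, ENNReal.toReal_ofReal (Real.exp_pos _).le, Real.log_exp]
  rw [klDiv_of_ac_of_integrable hac (hint.congr hllr.symm), integral_congr_ae hllr]
  simp

end KLDivergence

section MutualInformation

variable {α β : Type*} [MeasurableSpace α] [MeasurableSpace β]

lemma mutualInfo_compProd_le [MeasurableSpace.CountableOrCountablyGenerated (α × α) β]
    (μ : Measure α) [IsProbabilityMeasure μ] (κ : Kernel α β) [IsMarkovKernel κ]
    (σ : Kernel α α) [IsMarkovKernel σ] :
    mutualInfo (μ ⊗ₘ κ) ≤
      klDiv (μ ⊗ₘ σ) (μ.prod μ) + ∫⁻ p, klDiv (κ p.1) (κ p.2) ∂(μ ⊗ₘ σ) := by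
  have hfst : μ ⊗ₘ κ = ((μ ⊗ₘ σ) ⊗ₘ κ.prodMkRight α).map fun p => (p.1.1, p.2) := by
    refine Measure.ext_of_lintegral _ fun φ hφ => ?_
    rw [lintegral_map hφ (by fun_prop), Measure.lintegral_compProd (by fun_prop),
      Measure.lintegral_compProd (by fun_prop), Measure.lintegral_compProd (by fun_prop)]
    simp
  have hsnd : μ.prod (κ ∘ₘ μ) = ((μ.prod μ) ⊗ₘ κ.prodMkLeft α).map fun p => (p.1.1, p.2) := by
    refine Measure.ext_of_lintegral _ fun φ hφ => ?_
    rw [← Measure.compProd_const, ← Measure.compProd_const, lintegral_map hφ (by fun_prop),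
      Measure.lintegral_compProd (by fun_prop), Measure.lintegral_compProd (by fun_prop),
      Measure.lintegral_compProd (by fun_prop)]
    refine lintegral_congr fun u => ?_
    rw [Kernel.const_apply, Measure.lintegral_bind (by fun_prop) (by fun_prop)]
    simp
  rw [mutualInfo, Measure.fst_compProd, Measure.snd_compProd]
  nth_rw 1 [hfst]
  rw [hsnd]
  refine (klDiv_map_le _ _ (by fun_prop)).trans_eq ?_
  rw [klDiv_compProd_eq_add, klDiv_compProd_eq_lintegral]
  rfl

/-- The Markov kernel sending `u` to the probability measure `μ` conditioned on the slice
`{u' | (u, u') ∈ S}`. -/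
def sliceCond (μ : Measure α) [SFinite μ] {S : Set (α × α)} (hS : MeasurableSet S) :
    Kernel α α where
  toFun u := μ[|Prod.mk u ⁻¹' S]
  measurable' := by
    refine Measure.measurable_of_measurable_coe _ fun t ht => ?_
    simp_rw [cond_apply (measurable_prodMk_left hS)]
    refine (measurable_measure_prodMk_left hS).inv.mul ?_
    exact measurable_measure_prodMk_left (ν := μ) (hS.inter (measurable_snd ht))

theorem mutualInfo_compProd_le_neg_log_add
    [MeasurableSpace.CountableOrCountablyGenerated α α]
    [MeasurableSpace.CountableOrCountablyGenerated (α × α) β]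
    {μ : Measure α} [IsProbabilityMeasure μ] {κ : Kernel α β} [IsMarkovKernel κ]
    {S : Set (α × α)} (hS : MeasurableSet S) {θ : ℝ} (hθ : 0 < θ)
    (hμS : ∀ u, θ ≤ μ.real (Prod.mk u ⁻¹' S)) {D : ℝ≥0∞}
    (hD : ∀ p ∈ S, klDiv (κ p.1) (κ p.2) ≤ D) :
    mutualInfo (μ ⊗ₘ κ) ≤ ENNReal.ofReal (-Real.log θ) + D := by
  have hpos (u : α) : μ (Prod.mk u ⁻¹' S) ≠ 0 :=
    measureReal_ne_zero_iff (measure_ne_top _ _) |>.1 (hθ.trans_le (hμS u)).ne'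
  have : IsMarkovKernel (sliceCond μ hS) := ⟨fun u => cond_isProbabilityMeasure (hpos u)⟩
  have hcond : klDiv (μ ⊗ₘ sliceCond μ hS) (μ.prod μ) ≤ ENNReal.ofReal (-Real.log θ) := by
    rw [← Measure.compProd_const, klDiv_compProd_eq_lintegral]
    calc ∫⁻ u, klDiv (sliceCond μ hS u) (Kernel.const α μ u) ∂μ
        ≤ ∫⁻ _, ENNReal.ofReal (-Real.log θ) ∂μ := lintegral_mono fun u => by
          refine (klDiv_cond μ (measurable_prodMk_left hS) (hpos u)).trans_le ?_
          gcongr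
          exact hμS u
      _ = ENNReal.ofReal (-Real.log θ) := by simp
  have hmem : ∀ᵐ p ∂(μ ⊗ₘ sliceCond μ hS), p ∈ S :=
    Measure.ae_compProd_of_ae_ae hS (ae_of_all _ fun u => ae_cond_mem (measurable_prodMk_left hS))
  refine (mutualInfo_compProd_le μ κ (sliceCond μ hS)).trans (add_le_add hcond ?_)
  calc ∫⁻ p, klDiv (κ p.1) (κ p.2) ∂(μ ⊗ₘ sliceCond μ hS)
      ≤ ∫⁻ _, D ∂(μ ⊗ₘ sliceCond μ hS) := lintegral_mono_ae (hmem.mono hD)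
    _ = D := by simp

end MutualInformation

section PiDensity

variable {ι : Type*} [Fintype ι] {X : ι → Type*} [∀ i, MeasurableSpace (X i)]
  {μ : ∀ i, Measure (X i)} [∀ i, IsProbabilityMeasure (μ i)]

lemma lintegral_pi_prod {f : ∀ i, X i → ℝ≥0∞} (hf : ∀ i, Measurable (f i)) :
    ∫⁻ x, ∏ i, f i (x i) ∂Measure.pi μ = ∏ i, ∫⁻ t, f i t ∂μ i := by
  have hind : iIndepFun (fun i (x : ∀ i, X i) => f i (x i)) (Measure.pi μ) :=
    iIndepFun_pi fun i => (hf i).aemeasurable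
  rw [lintegral_prod_eq_prod_lintegral_of_indepFun Finset.univ _ hind
    fun i => (hf i).comp (measurable_pi_apply i)]
  refine Finset.prod_congr rfl fun i _ => ?_
  exact (measurePreserving_eval μ i).lintegral_comp (hf i)

lemma pi_withDensity {f : ∀ i, X i → ℝ≥0∞} (hf : ∀ i, Measurable (f i))
    [∀ i, SigmaFinite ((μ i).withDensity (f i))] :
    Measure.pi (fun i => (μ i).withDensity (f i)) =
      (Measure.pi μ).withDensity fun x => ∏ i, f i (x i) := by
  refine Measure.pi_eq fun s hs => ?_
  have hind : (Set.univ.pi s).indicator (fun x : ∀ i, X i => ∏ i, f i (x i)) =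
      fun x => ∏ i, (s i).indicator (f i) (x i) := by
    classical
    funext x
    by_cases hx : x ∈ Set.univ.pi s
    · rw [Set.indicator_of_mem hx]
      exact Finset.prod_congr rfl fun i _ => (Set.indicator_of_mem (hx i trivial) _).symm
    · rw [Set.indicator_of_notMem hx]
      simp only [Set.mem_pi, Set.mem_univ, true_imp_iff, not_forall] at hx
      obtain ⟨i, hi⟩ := hx
      exact (Finset.prod_eq_zero (Finset.mem_univ i) (Set.indicator_of_notMem hi _)).symm
  rw [withDensity_apply _ (.univ_pi hs), ← lintegral_indicator (.univ_pi hs), hind,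
    lintegral_pi_prod fun i => (hf i).indicator (hs i)]
  refine Finset.prod_congr rfl fun i _ => ?_
  rw [withDensity_apply _ (hs i), lintegral_indicator (hs i)]

end PiDensity

section ComplexGaussian

instance : IsProbabilityMeasure complexGaussian :=
  Measure.isProbabilityMeasure_map Complex.measurableEquivRealProd.symm.measurable.aemeasurable

lemma complexGaussian_eq_withDensity :
    complexGaussian = (volume : Measure ℂ).withDensity
      fun z => ENNReal.ofReal (Real.pi⁻¹ * Real.exp (-‖z‖ ^ 2)) := by
  have hv : (1 / 2 : ℝ≥0) ≠ 0 := by simp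
  refine Measure.ext_of_lintegral _ fun φ hφ => ?_
  rw [complexGaussian, lintegral_map hφ (MeasurableEquiv.measurable _),
    gaussianReal_of_var_ne_zero _ hv,
    prod_withDensity (measurable_gaussianPDF _ _) (measurable_gaussianPDF _ _),
    lintegral_withDensity_eq_lintegral_mul _ (by fun_prop) (by fun_prop),
    lintegral_withDensity_eq_lintegral_mul _ (by fun_prop) hφ,
    ← (Complex.volume_preserving_equiv_real_prod.symm).lintegral_comp (by fun_prop)]
  refine lintegral_congr fun p => ?_
  simp only [Pi.mul_apply]
  congr 1
  rw [gaussianPDF, gaussianPDF, ← ENNReal.ofReal_mul (gaussianPDFReal_nonneg _ _ _)]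
  congr 1
  simp only [gaussianPDFReal, Complex.measurableEquivRealProd_symm_apply,
    ← Complex.normSq_eq_norm_sq, Complex.normSq_mk]
  have hnormalization : 2 * Real.pi * ((1 / 2 : ℝ≥0) : ℝ) = Real.pi := by push_cast; ring
  have hexponent : 2 * ((1 / 2 : ℝ≥0) : ℝ) = 1 := by push_cast; ring
  rw [hnormalization, hexponent, mul_mul_mul_comm, ← mul_inv, Real.mul_self_sqrt Real.pi_pos.le,
    ← Real.exp_add]
  congr 2
  ring

lemma norm_sub_sq_eq_sub_re_mul_star (z c : ℂ) :
    ‖z - c‖ ^ 2 = ‖z‖ ^ 2 - 2 * (z * star c).re + ‖c‖ ^ 2 := by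
  simp only [← Complex.normSq_eq_norm_sq, Complex.normSq_sub, Complex.star_def]
  ring

lemma complexGaussian_map_add (c : ℂ) :
    complexGaussian.map (fun z => c + z) =
      complexGaussian.withDensity
        fun z => ENNReal.ofReal (Real.exp (2 * (z * star c).re - ‖c‖ ^ 2)) := by
  refine Measure.ext_of_lintegral _ fun φ hφ => ?_
  rw [lintegral_map hφ (by fun_prop),
    lintegral_withDensity_eq_lintegral_mul _ (by fun_prop) hφ, complexGaussian_eq_withDensity,
    lintegral_withDensity_eq_lintegral_mul _ (by fun_prop) (by fun_prop),
    lintegral_withDensity_eq_lintegral_mul _ (by fun_prop) (by fun_prop),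
    ← lintegral_sub_right_eq_self _ c]
  refine lintegral_congr fun z => ?_
  simp only [Pi.mul_apply, add_sub_cancel]
  rw [← mul_assoc]
  congr 1
  rw [← ENNReal.ofReal_mul (by positivity), mul_assoc, ← Real.exp_add,
    norm_sub_sq_eq_sub_re_mul_star]
  congr 3
  ring

lemma lintegral_exp_neg_mul_norm_sq {s : ℝ} (hs : 0 < s) :
    ∫⁻ z : ℂ, ENNReal.ofReal (Real.exp (-s * ‖z‖ ^ 2)) = ENNReal.ofReal (Real.pi / s) := by
  have hint : ∫ z : ℂ, Real.exp (-s * ‖z‖ ^ 2) = Real.pi / s := by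
    rw [GaussianFourier.integral_rexp_neg_mul_sq_norm (V := ℂ) hs]
    simp
  rw [← hint, ofReal_integral_eq_lintegral_ofReal _ (ae_of_all _ fun _ => (Real.exp_pos _).le)]
  exact not_imp_comm.1 integral_undef (hint.trans_ne (div_pos Real.pi_pos hs).ne')

lemma lintegral_exp_quadratic_complexGaussian {s : ℝ} (hs : 0 < 1 + s) (w : ℂ) :
    ∫⁻ h, ENNReal.ofReal (Real.exp (2 * (w * star h).re - s * ‖h‖ ^ 2)) ∂complexGaussian =
      ENNReal.ofReal (Real.exp (-Real.log (1 + s) + ‖w‖ ^ 2 / (1 + s))) := by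
  set c : ℂ := (((1 + s)⁻¹ : ℝ) : ℂ) * w with hc
  have hcomplete_square (h : ℂ) : -‖h‖ ^ 2 + (2 * (w * star h).re - s * ‖h‖ ^ 2) =
      ‖w‖ ^ 2 / (1 + s) + -(1 + s) * ‖h - c‖ ^ 2 := by
    have hre : (h * star c).re = (1 + s)⁻¹ * (w * star h).re := by
      rw [hc]
      generalize (1 + s)⁻¹ = t
      simp only [Complex.star_def, map_mul, Complex.conj_ofReal, Complex.mul_re, Complex.conj_re,
        Complex.conj_im, Complex.ofReal_re, Complex.ofReal_im, Complex.mul_im]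
      ring
    rw [norm_sub_sq_eq_sub_re_mul_star, hre, hc, norm_mul, mul_pow, Complex.norm_real,
      Real.norm_eq_abs, sq_abs]
    field_simp
    ring
  rw [complexGaussian_eq_withDensity,
    lintegral_withDensity_eq_lintegral_mul _ (by fun_prop) (by fun_prop)]
  calc ∫⁻ h : ℂ, ENNReal.ofReal (Real.pi⁻¹ * Real.exp (-‖h‖ ^ 2)) *
        ENNReal.ofReal (Real.exp (2 * (w * star h).re - s * ‖h‖ ^ 2))
      = ∫⁻ h : ℂ, ENNReal.ofReal (Real.pi⁻¹ * Real.exp (‖w‖ ^ 2 / (1 + s))) *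
          ENNReal.ofReal (Real.exp (-(1 + s) * ‖h - c‖ ^ 2)) := by
        refine lintegral_congr fun h => ?_
        rw [← ENNReal.ofReal_mul (by positivity), ← ENNReal.ofReal_mul (by positivity),
          mul_assoc, mul_assoc, ← Real.exp_add, ← Real.exp_add, hcomplete_square]
    _ = ENNReal.ofReal (Real.exp (-Real.log (1 + s) + ‖w‖ ^ 2 / (1 + s))) := by
        rw [lintegral_const_mul _ (by fun_prop),
          lintegral_sub_right_eq_self
            (fun h : ℂ => ENNReal.ofReal (Real.exp (-(1 + s) * ‖h‖ ^ 2))) c,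
          lintegral_exp_neg_mul_norm_sq hs, ← ENNReal.ofReal_mul (by positivity), Real.exp_add,
          Real.exp_neg, Real.exp_log hs]
        congr 1
        field_simp

lemma integral_sq_gaussianReal (v : ℝ≥0) : ∫ x, x ^ 2 ∂gaussianReal 0 v = v := by
  rw [← variance_of_integral_eq_zero (X := fun x => x) (by fun_prop) integral_id_gaussianReal,
    variance_fun_id_gaussianReal]

lemma norm_sq_measurableEquivRealProd_symm (p : ℝ × ℝ) :
    ‖Complex.measurableEquivRealProd.symm p‖ ^ 2 = p.1 ^ 2 + p.2 ^ 2 := by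
  rw [Complex.measurableEquivRealProd_symm_apply, ← Complex.normSq_eq_norm_sq, Complex.normSq_mk]
  ring

lemma integrable_norm_sq_complexGaussian : Integrable (fun z => ‖z‖ ^ 2) complexGaussian := by
  have hsq : Integrable (fun x : ℝ => x ^ 2) (gaussianReal 0 (1 / 2)) :=
    (memLp_id_gaussianReal 2).integrable_sq
  rw [complexGaussian, integrable_map_equiv]
  refine ((hsq.comp_fst _).add (hsq.comp_snd _)).congr (ae_of_all _ fun p => ?_)
  exact (norm_sq_measurableEquivRealProd_symm p).symm

lemma integral_norm_sq_complexGaussian : ∫ z, ‖z‖ ^ 2 ∂complexGaussian = 1 := by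
  have hsq : Integrable (fun x : ℝ => x ^ 2) (gaussianReal 0 (1 / 2)) :=
    (memLp_id_gaussianReal 2).integrable_sq
  rw [complexGaussian, integral_map_equiv]
  simp_rw [norm_sq_measurableEquivRealProd_symm]
  rw [integral_add (hsq.comp_fst _) (hsq.comp_snd _), integral_fun_fst (fun x : ℝ => x ^ 2),
    integral_fun_snd (fun x : ℝ => x ^ 2), integral_sq_gaussianReal]
  norm_num

lemma memLp_id_complexGaussian : MemLp (fun z : ℂ => z) 2 complexGaussian :=
  (memLp_two_iff_integrable_sq_norm (by fun_prop)).2 integrable_norm_sq_complexGaussian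

lemma integral_id_complexGaussian : ∫ z, z ∂complexGaussian = 0 := by
  rw [complexGaussian_eq_withDensity,
    integral_withDensity_eq_integral_toReal_smul (by fun_prop) (ae_of_all _ fun _ => by simp)]
  refine self_eq_neg.1 ?_
  rw [← integral_neg, ← integral_neg_eq_self]
  simp

end ComplexGaussian

section IndependentSums

variable {Ω : Type*} [MeasurableSpace Ω] {P : Measure Ω}

lemma integral_norm_sq_add_of_indepFun {X Y : Ω → ℂ} (hX : MemLp X 2 P) (hY : MemLp Y 2 P)
    (hXY : IndepFun X Y P) (hX0 : ∫ ω, X ω ∂P = 0) :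
    ∫ ω, ‖X ω + Y ω‖ ^ 2 ∂P = ∫ ω, ‖X ω‖ ^ 2 ∂P + ∫ ω, ‖Y ω‖ ^ 2 ∂P := by
  have hmul : Integrable (fun ω => X ω * star (Y ω)) P := hX.integrable_mul hY.star
  have hcross : ∫ ω, (X ω * star (Y ω)).re ∂P = 0 := by
    have hindep : IndepFun X (fun ω => star (Y ω)) P :=
      hXY.comp measurable_id continuous_star.measurable
    rw [← RCLike.re_eq_complex_re, integral_re hmul, hindep.integral_fun_mul_eq_mul_integral
      hX.aestronglyMeasurable hY.star.aestronglyMeasurable, hX0, zero_mul, map_zero]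
  have hexpand (ω : Ω) : ‖X ω + Y ω‖ ^ 2 =
      ‖X ω‖ ^ 2 + 2 * (X ω * star (Y ω)).re + ‖Y ω‖ ^ 2 := by
    simp only [← Complex.normSq_eq_norm_sq, Complex.normSq_add, Complex.star_def]
    ring
  have hX2 := hX.integrable_norm_pow two_ne_zero
  have hY2 := hY.integrable_norm_pow two_ne_zero
  have hcross2 : Integrable (fun ω => 2 * (X ω * star (Y ω)).re) P := hmul.re.const_mul 2
  have hXcross : Integrable (fun ω => ‖X ω‖ ^ 2 + 2 * (X ω * star (Y ω)).re) P := hX2.add hcross2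
  simp_rw [hexpand]
  rw [integral_add hXcross hY2, integral_add hX2 hcross2, integral_const_mul, hcross, mul_zero,
    add_zero]

lemma integral_norm_sq_sum_of_iIndepFun {ι : Type*} {X : ι → Ω → ℂ} (s : Finset ι)
    (hX : ∀ i, MemLp (X i) 2 P) (hindep : iIndepFun X P) (hX0 : ∀ i, ∫ ω, X i ω ∂P = 0) :
    ∫ ω, ‖∑ i ∈ s, X i ω‖ ^ 2 ∂P = ∑ i ∈ s, ∫ ω, ‖X i ω‖ ^ 2 ∂P := by
  classical
  induction s using Finset.induction_on with
  | empty => simp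
  | insert i s hi ih =>
    have hsum : IndepFun (X i) (fun ω => ∑ j ∈ s, X j ω) P := by
      simpa only [Finset.sum_fn] using (hindep.indepFun_finsetSum_of_notMem₀
        (fun j => (hX j).aestronglyMeasurable.aemeasurable) hi).symm
    simp_rw [Finset.sum_insert hi]
    rw [integral_norm_sq_add_of_indepFun (hX i) (memLp_finsetSum s fun j _ => hX j) hsum (hX0 i),
      ih]

end IndependentSums

section RowLaw

variable {ι : Type*} [Fintype ι]

/-- The law of one row `h v* + z` of the channel output for the transmitted vector `v`, where the
fading coefficient `h` and the entries of the noise `z` are i.i.d. `𝒞𝒩(0,1)`. -/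
def rowLaw (v : EuclideanSpace ℂ ι) : Measure (ι → ℂ) :=
  (complexGaussian.prod (Measure.pi fun _ : ι => complexGaussian)).map
    fun w l => w.1 * star (v l) + w.2 l

instance (v : EuclideanSpace ℂ ι) : IsProbabilityMeasure (rowLaw v) :=
  Measure.isProbabilityMeasure_map (by fun_prop)

/-- The log-density of `rowLaw v` with respect to the law of the noise. -/
def rowLogDensity (v : EuclideanSpace ℂ ι) (y : ι → ℂ) : ℝ :=
  -Real.log (1 + ‖v‖ ^ 2) + ‖∑ l, y l * v l‖ ^ 2 / (1 + ‖v‖ ^ 2)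

lemma measurable_rowLogDensity (v : EuclideanSpace ℂ ι) : Measurable (rowLogDensity v) := by
  unfold rowLogDensity
  fun_prop

lemma pi_complexGaussian_map_add (c : ι → ℂ) :
    (Measure.pi fun _ : ι => complexGaussian).map (fun z l => c l + z l) =
      (Measure.pi fun _ : ι => complexGaussian).withDensity fun y =>
        ∏ l, ENNReal.ofReal (Real.exp (2 * (y l * star (c l)).re - ‖c l‖ ^ 2)) := by
  have (l : ι) : IsProbabilityMeasure (complexGaussian.withDensity fun z =>
      ENNReal.ofReal (Real.exp (2 * (z * star (c l)).re - ‖c l‖ ^ 2))) := by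
    rw [← complexGaussian_map_add]
    exact Measure.isProbabilityMeasure_map (by fun_prop)
  rw [Measure.pi_map_pi (μ := fun _ : ι => complexGaussian) (f := fun l z => c l + z)
    fun l => by fun_prop]
  simp_rw [complexGaussian_map_add]
  exact pi_withDensity fun l => by fun_prop

lemma prod_rowShift_density (v : EuclideanSpace ℂ ι) (h : ℂ) (y : ι → ℂ) :
    ∏ l, ENNReal.ofReal (Real.exp
        (2 * (y l * star (h * star (v l))).re - ‖h * star (v l)‖ ^ 2)) =
      ENNReal.ofReal (Real.exp (2 * ((∑ l, y l * v l) * star h).re - ‖v‖ ^ 2 * ‖h‖ ^ 2)) := by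
  rw [← ENNReal.ofReal_prod_of_nonneg fun _ _ => (Real.exp_pos _).le, ← Real.exp_sum,
    Finset.sum_sub_distrib, ← Finset.mul_sum, EuclideanSpace.norm_sq_eq, Finset.sum_mul,
    Finset.sum_mul, Complex.re_sum]
  congr 4
  · refine Finset.sum_congr rfl fun l _ => ?_
    rw [star_mul, star_star, mul_assoc]
  · funext l
    rw [norm_mul, norm_star, mul_pow, mul_comm]

lemma rowLaw_eq_withDensity (v : EuclideanSpace ℂ ι) :
    rowLaw v = (Measure.pi fun _ : ι => complexGaussian).withDensity
      fun y => ENNReal.ofReal (Real.exp (rowLogDensity v y)) := by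
  have hdens := measurable_rowLogDensity v
  refine Measure.ext_of_lintegral _ fun φ hφ => ?_
  have hfixed_fading (h : ℂ) :
      ∫⁻ z, φ (fun l => h * star (v l) + z l) ∂(Measure.pi fun _ : ι => complexGaussian) =
        ∫⁻ y, ENNReal.ofReal (Real.exp (2 * ((∑ l, y l * v l) * star h).re - ‖v‖ ^ 2 * ‖h‖ ^ 2)) *
          φ y ∂(Measure.pi fun _ : ι => complexGaussian) := by
    rw [← lintegral_map (f := φ) (g := fun (z : ι → ℂ) l => h * star (v l) + z l) hφ
      (by fun_prop), pi_complexGaussian_map_add fun l => h * star (v l)]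
    simp_rw [prod_rowShift_density]
    exact lintegral_withDensity_eq_lintegral_mul _ (by fun_prop) hφ
  rw [rowLaw, lintegral_map hφ (by fun_prop), lintegral_prod _ (by fun_prop),
    lintegral_withDensity_eq_lintegral_mul _ (by fun_prop) hφ]
  simp_rw [hfixed_fading]
  rw [lintegral_lintegral_swap (by fun_prop)]
  refine lintegral_congr fun y => ?_
  rw [lintegral_mul_const _ (by fun_prop),
    lintegral_exp_quadratic_complexGaussian (by positivity), Pi.mul_apply, rowLogDensity]

lemma memLp_pi_complexGaussian_mul (w : ι → ℂ) (l : ι) :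
    MemLp (fun z : ι → ℂ => z l * w l) 2 (Measure.pi fun _ : ι => complexGaussian) :=
  (memLp_id_complexGaussian.comp_measurePreserving
    (measurePreserving_eval (fun _ : ι => complexGaussian) l)).mul_const (w l)

lemma integral_norm_sq_sum_pi_complexGaussian (w : EuclideanSpace ℂ ι) :
    ∫ z, ‖∑ l, z l * w l‖ ^ 2 ∂(Measure.pi fun _ : ι => complexGaussian) = ‖w‖ ^ 2 := by
  have hindep : iIndepFun (fun l (z : ι → ℂ) => z l * w l)
      (Measure.pi fun _ : ι => complexGaussian) :=
    iIndepFun_pi (X := fun l z => z * w l) fun l => by fun_prop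
  have hmean (l : ι) : ∫ z, z l * w l ∂(Measure.pi fun _ : ι => complexGaussian) = 0 := by
    rw [integral_mul_const, integral_eval, integral_id_complexGaussian, zero_mul]
  have hvar (l : ι) :
      ∫ z, ‖z l * w l‖ ^ 2 ∂(Measure.pi fun _ : ι => complexGaussian) = ‖w l‖ ^ 2 := by
    simp_rw [norm_mul, mul_pow]
    rw [integral_mul_const, integral_comp_eval (μ := fun _ : ι => complexGaussian) (i := l)
      (f := fun z => ‖z‖ ^ 2) (by fun_prop), integral_norm_sq_complexGaussian, one_mul]
  rw [integral_norm_sq_sum_of_iIndepFun Finset.univ (memLp_pi_complexGaussian_mul w) hindep hmean,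
    EuclideanSpace.norm_sq_eq]
  exact Finset.sum_congr rfl fun l _ => hvar l

lemma sum_rowShift_mul (v w : EuclideanSpace ℂ ι) (h : ℂ) (z : ι → ℂ) :
    ∑ l, (h * star (v l) + z l) * w l = h * inner ℂ v w + ∑ l, z l * w l := by
  simp only [add_mul, Finset.sum_add_distrib, PiLp.inner_apply, RCLike.inner_apply,
    Finset.mul_sum, Complex.star_def, mul_assoc, mul_comm (w _)]

lemma memLp_fading_mul (c : ℂ) :
    MemLp (fun p : ℂ × (ι → ℂ) => p.1 * c) 2
      (complexGaussian.prod (Measure.pi fun _ : ι => complexGaussian)) :=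
  (memLp_id_complexGaussian.mul_const c).comp_fst _

lemma memLp_noise_sum (w : ι → ℂ) :
    MemLp (fun p : ℂ × (ι → ℂ) => ∑ l, p.2 l * w l) 2
      (complexGaussian.prod (Measure.pi fun _ : ι => complexGaussian)) :=
  (memLp_finsetSum Finset.univ fun l _ => memLp_pi_complexGaussian_mul w l).comp_snd _

lemma integrable_norm_sq_rowLaw (v w : EuclideanSpace ℂ ι) :
    Integrable (fun y => ‖∑ l, y l * w l‖ ^ 2) (rowLaw v) := by
  rw [rowLaw, integrable_map_measure (Measurable.aestronglyMeasurable (by fun_prop)) (by fun_prop)]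
  refine (((memLp_fading_mul (inner ℂ v w)).add (memLp_noise_sum w)).integrable_norm_pow
    two_ne_zero).congr (ae_of_all _ fun p => ?_)
  simp only [Function.comp_apply, Pi.add_apply, sum_rowShift_mul]

lemma integral_norm_sq_rowLaw (v w : EuclideanSpace ℂ ι) :
    ∫ y, ‖∑ l, y l * w l‖ ^ 2 ∂rowLaw v = ‖inner ℂ v w‖ ^ 2 + ‖w‖ ^ 2 := by
  have hindep : IndepFun (fun p : ℂ × (ι → ℂ) => p.1 * inner ℂ v w)
      (fun p => ∑ l, p.2 l * w l)
      (complexGaussian.prod (Measure.pi fun _ : ι => complexGaussian)) :=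
    indepFun_prod (X := fun h : ℂ => h * inner ℂ v w) (Y := fun z : ι → ℂ => ∑ l, z l * w l)
      (by fun_prop) (by fun_prop)
  have hmean : ∫ p, p.1 * inner ℂ v w
      ∂complexGaussian.prod (Measure.pi fun _ : ι => complexGaussian) = 0 := by
    rw [integral_fun_fst (fun h : ℂ => h * inner ℂ v w), integral_mul_const,
      integral_id_complexGaussian, zero_mul, smul_zero]
  rw [rowLaw, integral_map (by fun_prop) (Measurable.aestronglyMeasurable (by fun_prop))]
  simp_rw [sum_rowShift_mul]
  rw [integral_norm_sq_add_of_indepFun (memLp_fading_mul _) (memLp_noise_sum w) hindep hmean,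
    integral_fun_fst (fun h : ℂ => ‖h * inner ℂ v w‖ ^ 2),
    integral_fun_snd (fun z : ι → ℂ => ‖∑ l, z l * w l‖ ^ 2),
    integral_norm_sq_sum_pi_complexGaussian]
  simp_rw [norm_mul, mul_pow]
  rw [integral_mul_const, integral_norm_sq_complexGaussian]
  simp only [probReal_univ, one_smul, one_mul]

lemma rowLaw_eq_withDensity_rowLaw (v w : EuclideanSpace ℂ ι) :
    rowLaw v = (rowLaw w).withDensity
      fun y => ENNReal.ofReal (Real.exp (rowLogDensity v y - rowLogDensity w y)) := by
  have hv := measurable_rowLogDensity v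
  have hw := measurable_rowLogDensity w
  rw [rowLaw_eq_withDensity w, ← withDensity_mul _ (by fun_prop) (by fun_prop),
    rowLaw_eq_withDensity v]
  congr 1 with y
  rw [Pi.mul_apply, ← ENNReal.ofReal_mul (Real.exp_pos _).le, ← Real.exp_add, add_sub_cancel]

theorem klDiv_rowLaw {v w : EuclideanSpace ℂ ι} (hvw : ‖v‖ = ‖w‖) :
    klDiv (rowLaw v) (rowLaw w) =
      ENNReal.ofReal ((‖v‖ ^ 4 - ‖inner ℂ v w‖ ^ 2) / (1 + ‖v‖ ^ 2)) := by
  have hdiff (y : ι → ℂ) : rowLogDensity v y - rowLogDensity w y =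
      (‖∑ l, y l * v l‖ ^ 2 - ‖∑ l, y l * w l‖ ^ 2) / (1 + ‖v‖ ^ 2) := by
    rw [rowLogDensity, rowLogDensity, ← hvw]
    ring
  have hdens := rowLaw_eq_withDensity_rowLaw v w
  simp_rw [hdiff] at hdens
  have hint : Integrable (fun y =>
      (‖∑ l, y l * v l‖ ^ 2 - ‖∑ l, y l * w l‖ ^ 2) / (1 + ‖v‖ ^ 2)) (rowLaw v) :=
    ((integrable_norm_sq_rowLaw v v).sub (integrable_norm_sq_rowLaw v w)).div_const _
  have hprob := (inferInstance : IsProbabilityMeasure (rowLaw v))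
  rw [hdens] at hint hprob
  conv_lhs => rw [hdens]
  rw [klDiv_withDensity_exp (by fun_prop) hint, ← hdens, integral_div,
    integral_sub (integrable_norm_sq_rowLaw v v) (integrable_norm_sq_rowLaw v w),
    integral_norm_sq_rowLaw, integral_norm_sq_rowLaw, ← hvw, add_sub_add_right_eq_sub,
    inner_self_eq_norm_sq_to_K, norm_pow, RCLike.norm_ofReal, abs_norm,
    ← pow_mul]

end RowLaw

section Isotropic

variable {L : ℕ}

instance [NeZero L] : IsProbabilityMeasure (isotropic L) := by
  have hsphere : (volume : Measure (EuclideanSpace ℂ (Fin L))).toSphere Set.univ ≠ 0 :=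
    mt Measure.measure_univ_eq_zero.1 (Measure.toSphere_ne_zero _)
  refine ⟨?_⟩
  rw [isotropic, Measure.smul_apply, smul_eq_mul,
    ENNReal.inv_mul_cancel hsphere (measure_ne_top _ _)]

lemma isotropic_ball_ge [NeZero L] {r : ℝ} (hr : 0 < r) (hr2 : r ≤ 2) (u : UnitVec L) :
    (r / 4) ^ (2 * L) ≤ (isotropic L).real (Metric.ball u r) := by
  set vol := (volume : Measure (EuclideanSpace ℂ (Fin L)))
  have hdim : Module.finrank ℝ (EuclideanSpace ℂ (Fin L)) = 2 * L := by
    rw [finrank_real_of_complex, finrank_euclideanSpace_fin]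
  have hcap := vol.toSphereBallBound_mul_measureReal_unitBall_le_toSphere_ball hr u
  have hsphere := vol.toSphere_real_apply_univ
  have hL : 2 * L ≠ 0 := mul_ne_zero two_ne_zero (NeZero.ne L)
  have hbound : (Measure.toSphereBallBound (2 * L) r : ℝ) = (2 * L : ℕ) * (r / 4) ^ (2 * L) := by
    rw [Measure.toSphereBallBound, if_pos ⟨hL, hr⟩]
    push_cast
    rw [Real.coe_toNNReal _ hr.le, min_eq_left hr2]
  have hball_pos : 0 < vol.real (Metric.ball 0 1) :=
    ENNReal.toReal_pos (Metric.measure_ball_pos _ _ one_pos).ne' measure_ball_lt_top.ne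
  rw [hdim] at hcap hsphere
  rw [hbound] at hcap
  have : (0 : ℝ) < (2 * L : ℕ) := by exact_mod_cast Nat.pos_of_ne_zero hL
  have hnormalize : (isotropic L).real (Metric.ball u r) =
      (vol.toSphere.real Set.univ)⁻¹ * vol.toSphere.real (Metric.ball u r) := by
    rw [isotropic, measureReal_ennreal_smul_apply, ENNReal.toReal_inv, ← measureReal_def]
  rw [hnormalize, hsphere, ← div_eq_inv_mul, le_div_iff₀ (by positivity)]
  linarith

lemma one_sub_norm_inner_sq_le (u v : UnitVec L) :
    1 - ‖inner ℂ u.1 v.1‖ ^ 2 ≤ dist u v ^ 2 := by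
  have hre : RCLike.re (inner ℂ u.1 v.1) ≤ ‖inner ℂ u.1 v.1‖ := RCLike.re_le_norm _
  rw [Subtype.dist_eq, dist_eq_norm, norm_sub_sq (𝕜 := ℂ) u.1 v.1, norm_eq_of_mem_sphere,
    norm_eq_of_mem_sphere]
  nlinarith [sq_nonneg (1 - ‖inner ℂ u.1 v.1‖)]

end Isotropic

section Channel

variable {N L : ℕ}

/-- The channel with energy `a`, as the Markov kernel sending the input `u` to the law of the
output `Y`. -/
def channelKernel (N L : ℕ) (a : ℝ≥0) : Kernel (UnitVec L) (Fin N → Fin L → ℂ) :=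
  (Kernel.id ×ₖ Kernel.const _ ((Measure.pi fun _ : Fin N => complexGaussian).prod
    (Measure.pi fun _ : Fin N => Measure.pi fun _ : Fin L => complexGaussian))).map
    fun w => channelOutput a w.1 w.2.1 w.2.2

lemma measurable_channelOutput (a : ℝ≥0) :
    Measurable fun w : UnitVec L × (Fin N → ℂ) × (Fin N → Fin L → ℂ) =>
      channelOutput a w.1 w.2.1 w.2.2 := by
  unfold channelOutput
  fun_prop

instance (a : ℝ≥0) : IsMarkovKernel (channelKernel N L a) :=
  Kernel.IsMarkovKernel.map _ (measurable_channelOutput a)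

lemma channelKernel_apply (a : ℝ≥0) (u : UnitVec L) :
    channelKernel N L a u =
      ((Measure.pi fun _ : Fin N => complexGaussian).prod
        (Measure.pi fun _ : Fin N => Measure.pi fun _ : Fin L => complexGaussian)).map
        fun w => channelOutput a u w.1 w.2 := by
  have hmeas := measurable_channelOutput (N := N) (L := L) a
  rw [channelKernel, Kernel.map_apply _ hmeas, Kernel.prod_apply, Kernel.id_apply,
    Kernel.const_apply, Measure.dirac_prod, Measure.map_map hmeas (by fun_prop)]
  rfl

lemma shapeOutputLaw_eq_compProd [NeZero L] (a : ℝ≥0) :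
    shapeOutputLaw N L a = isotropic L ⊗ₘ channelKernel N L a := by
  have hmeas := measurable_channelOutput (N := N) (L := L) a
  refine Measure.ext_of_lintegral _ fun φ hφ => ?_
  rw [shapeOutputLaw, lintegral_map hφ (by fun_prop), lintegral_prod _ (by fun_prop),
    Measure.lintegral_compProd hφ]
  refine lintegral_congr fun u => ?_
  rw [channelKernel_apply, lintegral_map (by fun_prop) (by fun_prop)]

lemma channelKernel_apply_eq_pi (a : ℝ≥0) (u : UnitVec L) :
    channelKernel N L a u = Measure.pi fun _ : Fin N => rowLaw ((Real.sqrt a : ℂ) • u.1) := by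
  have hrows := measurePreserving_arrowProdEquivProdArrow ℂ (Fin L → ℂ) (Fin N)
    (fun _ => complexGaussian) fun _ => Measure.pi fun _ : Fin L => complexGaussian
  have hmeas : Measurable fun w : (Fin N → ℂ) × (Fin N → Fin L → ℂ) =>
      channelOutput a u w.1 w.2 :=
    (measurable_channelOutput a).comp measurable_prodMk_left
  rw [channelKernel_apply, ← hrows.map_eq, Measure.map_map hmeas hrows.measurable]
  exact Measure.pi_map_pi (f := fun _ (p : ℂ × (Fin L → ℂ)) l =>
    p.1 * star ((Real.sqrt a : ℂ) * u.1 l) + p.2 l) fun _ => by fun_prop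

lemma klDiv_channelKernel (a : ℝ≥0) (u v : UnitVec L) :
    klDiv (channelKernel N L a u) (channelKernel N L a v) =
      ENNReal.ofReal (N * (a ^ 2 / (1 + a)) * (1 - ‖inner ℂ u.1 v.1‖ ^ 2)) := by
  have hnorm (w : UnitVec L) : ‖(Real.sqrt a : ℂ) • w.1‖ = Real.sqrt a := by
    rw [norm_smul, norm_eq_of_mem_sphere, mul_one, Complex.norm_real,
      Real.norm_of_nonneg (Real.sqrt_nonneg _)]
  have hinner : ‖inner ℂ ((Real.sqrt a : ℂ) • u.1) ((Real.sqrt a : ℂ) • v.1)‖ =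
      a * ‖inner ℂ u.1 v.1‖ := by
    rw [inner_smul_left, inner_smul_right, Complex.conj_ofReal, ← mul_assoc, ← Complex.ofReal_mul,
      Real.mul_self_sqrt a.coe_nonneg, norm_mul, Complex.norm_real,
      Real.norm_of_nonneg a.coe_nonneg]
  have hpow : Real.sqrt a ^ 4 = (a : ℝ) ^ 2 := by
    rw [pow_mul (Real.sqrt a) 2 2, Real.sq_sqrt a.coe_nonneg]
  rw [channelKernel_apply_eq_pi, channelKernel_apply_eq_pi, klDiv_pi, Finset.sum_const,
    Finset.card_univ, Fintype.card_fin, klDiv_rowLaw ((hnorm u).trans (hnorm v).symm), hinner,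
    hnorm, hpow, Real.sq_sqrt a.coe_nonneg, ← ENNReal.ofReal_nsmul, nsmul_eq_mul]
  congr 1
  ring

end Channel

section MutualInformationBounds

variable {N L : ℕ} [NeZero L]

lemma mutualInfo_shapeOutputLaw_le_quadratic (a : ℝ≥0) :
    mutualInfo (shapeOutputLaw N L a) ≤ ENNReal.ofReal (N * (a ^ 2 / (1 + a))) := by
  have hkl (p : UnitVec L × UnitVec L) : klDiv (channelKernel N L a p.1) (channelKernel N L a p.2)
      ≤ ENNReal.ofReal (N * (a ^ 2 / (1 + a))) := by
    rw [klDiv_channelKernel]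
    refine ENNReal.ofReal_le_ofReal (mul_le_of_le_one_right (by positivity) ?_)
    exact sub_le_self _ (by positivity)
  rw [shapeOutputLaw_eq_compProd]
  refine (mutualInfo_compProd_le_neg_log_add MeasurableSet.univ one_pos (fun u => ?_)
    fun p _ => hkl p).trans_eq ?_
  · rw [Set.preimage_univ, probReal_univ]
  · rw [Real.log_one, neg_zero, ENNReal.ofReal_zero, zero_add]

lemma mutualInfo_shapeOutputLaw_le_localized (a : ℝ≥0) {r : ℝ} (hr : 0 < r) (hr2 : r ≤ 2) :
    mutualInfo (shapeOutputLaw N L a) ≤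
      ENNReal.ofReal (L * Real.log (16 / r ^ 2) + N * (a ^ 2 / (1 + a)) * r ^ 2) := by
  have hcap (u : UnitVec L) : (r / 4) ^ (2 * L) ≤
      (isotropic L).real (Prod.mk u ⁻¹' {p | dist p.1 p.2 < r}) := by
    have hslice : Prod.mk u ⁻¹' {p | dist p.1 p.2 < r} = Metric.ball u r := by
      ext v
      exact Metric.mem_ball'.symm
    exact hslice ▸ isotropic_ball_ge hr hr2 u
  have hkl (p : UnitVec L × UnitVec L) (hp : p ∈ {p | dist p.1 p.2 < r}) :
      klDiv (channelKernel N L a p.1) (channelKernel N L a p.2) ≤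
        ENNReal.ofReal (N * (a ^ 2 / (1 + a)) * r ^ 2) := by
    rw [klDiv_channelKernel]
    gcongr
    exact (one_sub_norm_inner_sq_le p.1 p.2).trans (by gcongr; exact le_of_lt hp)
  have hlog : -Real.log ((r / 4) ^ (2 * L)) = L * Real.log (16 / r ^ 2) := by
    rw [Real.log_pow, ← mul_neg, ← Real.log_inv, inv_div,
      show (16 : ℝ) / r ^ 2 = (4 / r) ^ 2 by rw [div_pow]; norm_num, Real.log_pow]
    push_cast
    ring
  have hlog_nonneg : 0 ≤ Real.log (16 / r ^ 2) := by
    refine Real.log_nonneg ((one_le_div (by positivity)).2 ?_)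
    nlinarith
  rw [shapeOutputLaw_eq_compProd, ENNReal.ofReal_add (by positivity) (by positivity), ← hlog]
  exact mutualInfo_compProd_le_neg_log_add (measurableSet_lt (by fun_prop) (by fun_prop))
    (by positivity) hcap hkl

lemma sq_div_one_add_le {x : ℝ} (hx : 0 ≤ x) : x ^ 2 / (1 + x) ≤ x := by
  rw [div_le_iff₀ (by positivity)]
  nlinarith

lemma ofReal_mul_coe {d : ℝ} (hd : 0 ≤ d) (a : ℝ≥0) :
    ENNReal.ofReal (d * a) = ENNReal.ofReal d * a := by
  rw [ENNReal.ofReal_mul hd, ENNReal.ofReal_coe_nnreal]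

lemma mutualInfo_shapeOutputLaw_le_linear (a : ℝ≥0) :
    mutualInfo (shapeOutputLaw N L a) ≤ ENNReal.ofReal N * a := by
  rw [← ofReal_mul_coe N.cast_nonneg]
  refine (mutualInfo_shapeOutputLaw_le_quadratic a).trans (ENNReal.ofReal_le_ofReal ?_)
  gcongr
  exact sq_div_one_add_le a.coe_nonneg

lemma mutualInfo_shapeOutputLaw_le_log (hN : 0 < N) (a : ℝ≥0) :
    mutualInfo (shapeOutputLaw N L a) ≤
      ENNReal.ofReal (L * Real.log (16 * N)) + ENNReal.ofReal 1 * a := by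
  have hN1 : (1 : ℝ) ≤ N := by exact_mod_cast hN
  have hlog : 0 ≤ Real.log (16 * N) := Real.log_nonneg (by linarith)
  have hradius : (Real.sqrt N)⁻¹ ≤ 2 :=
    (inv_le_one_of_one_le₀ (Real.one_le_sqrt.2 hN1)).trans one_le_two
  rw [← ofReal_mul_coe zero_le_one, ← ENNReal.ofReal_add (by positivity) (by positivity)]
  refine (mutualInfo_shapeOutputLaw_le_localized a (by positivity) hradius).trans
    (ENNReal.ofReal_le_ofReal ?_)
  have hcancel : (N : ℝ) * ((a : ℝ) ^ 2 / (1 + a)) * (N : ℝ)⁻¹ = a ^ 2 / (1 + a) := by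
    field_simp
  rw [inv_pow, Real.sq_sqrt N.cast_nonneg, div_inv_eq_mul, hcancel, one_mul]
  gcongr
  exact sq_div_one_add_le a.coe_nonneg

lemma localized_bound_at_radius_le {p q x : ℝ} (hp : 0 < p) (hq : 0 < q) (hx : 0 < x) :
    q ^ 2 * Real.log (16 / (q / (x * p)) ^ 2) + p ^ 2 * (x ^ 2 / (1 + x)) * (q / (x * p)) ^ 2 ≤
      8 * (p * q) * x := by
  have hlog : Real.log (16 / (q / (x * p)) ^ 2) ≤ 8 * (x * p / q) - 2 := by
    rw [show (16 : ℝ) / (q / (x * p)) ^ 2 = (4 * (x * p / q)) ^ 2 by field_simp; norm_num,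
      Real.log_pow]
    have := Real.log_le_sub_one_of_pos (show 0 < 4 * (x * p / q) by positivity)
    push_cast
    linarith
  have hsq : x ^ 2 / (1 + x) ≤ x ^ 2 := div_le_self (by positivity) (by linarith)
  calc q ^ 2 * Real.log (16 / (q / (x * p)) ^ 2) +
        p ^ 2 * (x ^ 2 / (1 + x)) * (q / (x * p)) ^ 2
      ≤ q ^ 2 * (8 * (x * p / q) - 2) + p ^ 2 * x ^ 2 * (q / (x * p)) ^ 2 := by gcongr
    _ = 8 * (p * q) * x - q ^ 2 := by
        field_simp
        ring
    _ ≤ 8 * (p * q) * x := sub_le_self _ (by positivity)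

lemma mutualInfo_shapeOutputLaw_le_sqrt (hN : 0 < N) (a : ℝ≥0) :
    mutualInfo (shapeOutputLaw N L a) ≤ ENNReal.ofReal (8 * Real.sqrt (N * L)) * a := by
  have hp : 0 < Real.sqrt N := Real.sqrt_pos.2 (by exact_mod_cast hN)
  have hq : 0 < Real.sqrt L := Real.sqrt_pos.2 (by exact_mod_cast Nat.pos_of_ne_zero (NeZero.ne L))
  rw [← ofReal_mul_coe (by positivity), Real.sqrt_mul N.cast_nonneg]
  rcases le_total (a * Real.sqrt N) (Real.sqrt L) with hsmall | hlarge
  · refine (mutualInfo_shapeOutputLaw_le_quadratic a).trans (ENNReal.ofReal_le_ofReal ?_)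
    calc (N : ℝ) * (a ^ 2 / (1 + a)) ≤ N * a ^ 2 := by
          gcongr
          exact div_le_self (by positivity) (by simp)
      _ = Real.sqrt N * a * (a * Real.sqrt N) := by
          nth_rw 1 [← Real.sq_sqrt N.cast_nonneg]
          ring
      _ ≤ Real.sqrt N * a * Real.sqrt L := by gcongr
      _ ≤ 8 * (Real.sqrt N * Real.sqrt L) * a := by nlinarith [mul_pos hp hq, a.coe_nonneg]
  · have ha : (0 : ℝ) < a := pos_of_mul_pos_left (hq.trans_le hlarge) hp.le
    -- At radius `√L / (a√N)` the divergence term of the localized bound is at most `L`, which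
    -- `log t ≤ t - 1` lets the entropy term absorb.
    have hradius : Real.sqrt L / (a * Real.sqrt N) ≤ 2 :=
      ((div_le_one (by positivity)).2 hlarge).trans one_le_two
    refine (mutualInfo_shapeOutputLaw_le_localized a (by positivity) hradius).trans
      (ENNReal.ofReal_le_ofReal ?_)
    simpa only [Real.sq_sqrt (Nat.cast_nonneg _)] using localized_bound_at_radius_le hp hq ha

end MutualInformationBounds

section Capacity

variable {P Δf : ℝ} {B N L : ℕ}

lemma shapeInfo_le_of_affine {c d m : ℝ} (hc : 0 ≤ c) (hd : 0 ≤ d) (hm : 0 ≤ m)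
    (hinfo : ∀ a, mutualInfo (shapeOutputLaw N L a) ≤ ENNReal.ofReal c + ENNReal.ofReal d * a)
    {p : Measure ℝ≥0} [IsProbabilityMeasure p] (hp : ∫⁻ a, (a : ℝ≥0∞) ∂p ≤ ENNReal.ofReal m) :
    shapeInfo N L p ≤ ENNReal.ofReal (c + d * m) := by
  calc shapeInfo N L p ≤ ∫⁻ a, (ENNReal.ofReal c + ENNReal.ofReal d * a) ∂p := lintegral_mono hinfo
    _ = ENNReal.ofReal c + ENNReal.ofReal d * ∫⁻ a, (a : ℝ≥0∞) ∂p := by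
        rw [lintegral_add_left measurable_const, lintegral_const_mul _ (by fun_prop),
          lintegral_const, measure_univ, mul_one]
    _ ≤ ENNReal.ofReal c + ENNReal.ofReal d * ENNReal.ofReal m := by gcongr
    _ = ENNReal.ofReal (c + d * m) := by
        rw [← ENNReal.ofReal_mul hd, ← ENNReal.ofReal_add hc (by positivity)]

lemma shapeCapacity_le_of_affine (hP : 0 ≤ P) (hΔf : 0 ≤ Δf) (hL : 0 < L) {c d : ℝ}
    (hc : 0 ≤ c) (hd : 0 ≤ d)
    (hinfo : ∀ a, mutualInfo (shapeOutputLaw N L a) ≤ ENNReal.ofReal c + ENNReal.ofReal d * a) :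
    shapeCapacity P Δf B N L ≤ ENNReal.ofReal (Δf * (B * c / L + d * P)) := by
  have : (0 : ℝ) < L := by exact_mod_cast hL
  refine iSup_le fun M => iSup_le fun hM => iSup_le fun p => iSup_le fun _ => iSup_le fun hp => ?_
  have hM0 : (0 : ℝ) < M := by exact_mod_cast hM.1
  have hMB : (M : ℝ) ≤ B := by exact_mod_cast hM.2
  calc ENNReal.ofReal (M * Δf / L) * shapeInfo N L p
      ≤ ENNReal.ofReal (M * Δf / L) * ENNReal.ofReal (c + d * (P * L / M)) := by
        gcongr
        exact shapeInfo_le_of_affine hc hd (by positivity) hinfo hp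
    _ = ENNReal.ofReal (Δf * (M * c / L + d * P)) := by
        rw [← ENNReal.ofReal_mul (by positivity)]
        congr 1
        field_simp
    _ ≤ ENNReal.ofReal (Δf * (B * c / L + d * P)) := by gcongr

lemma shapeCapacity_le_of_linear (hP : 0 ≤ P) (hΔf : 0 ≤ Δf) (hL : 0 < L) {d : ℝ} (hd : 0 ≤ d)
    (hinfo : ∀ a, mutualInfo (shapeOutputLaw N L a) ≤ ENNReal.ofReal d * a) :
    shapeCapacity P Δf B N L ≤ ENNReal.ofReal (Δf * P * d) := by
  refine (shapeCapacity_le_of_affine hP hΔf hL le_rfl hd fun a => ?_).trans_eq ?_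
  · rw [ENNReal.ofReal_zero, zero_add]
    exact hinfo a
  · rw [mul_zero, zero_div, zero_add, mul_assoc, mul_comm d]

lemma shapeCapacity_le_linear (hP : 0 ≤ P) (hΔf : 0 ≤ Δf) (hL : 0 < L) :
    shapeCapacity P Δf B N L ≤ ENNReal.ofReal (Δf * P * N) :=
  have : NeZero L := ⟨hL.ne'⟩
  shapeCapacity_le_of_linear hP hΔf hL N.cast_nonneg mutualInfo_shapeOutputLaw_le_linear

lemma shapeCapacity_le_sqrt (hP : 0 ≤ P) (hΔf : 0 ≤ Δf) (hL : 0 < L) (hN : 0 < N) :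
    shapeCapacity P Δf B N L ≤ ENNReal.ofReal (Δf * P * (8 * Real.sqrt (N * L))) :=
  have : NeZero L := ⟨hL.ne'⟩
  shapeCapacity_le_of_linear hP hΔf hL (by positivity) (mutualInfo_shapeOutputLaw_le_sqrt hN)

lemma shapeCapacity_le_log (hP : 0 ≤ P) (hΔf : 0 ≤ Δf) (hB : 0 < B) (hL : 0 < L) (hN : 16 ≤ N) :
    shapeCapacity P Δf B N L ≤ ENNReal.ofReal (Δf * (2 + P) * (B * Real.log N)) := by
  have : NeZero L := ⟨hL.ne'⟩
  have : (0 : ℝ) < L := by exact_mod_cast hL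
  have hB1 : (1 : ℝ) ≤ B := by exact_mod_cast hB
  have hN16 : (16 : ℝ) ≤ N := by exact_mod_cast hN
  have hlogN : 1 ≤ Real.log N := by
    rw [Real.le_log_iff_exp_le (by linarith)]
    linarith [Real.exp_one_lt_d9]
  have hlog : Real.log (16 * N) ≤ 2 * Real.log N := by
    rw [Real.log_mul (by norm_num) (by linarith)]
    linarith [Real.log_le_log (by norm_num) hN16]
  have hlog_nonneg : 0 ≤ Real.log (16 * N) := Real.log_nonneg (by linarith)
  have hBlog : 1 ≤ B * Real.log N := one_le_mul_of_one_le_of_one_le hB1 hlogN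
  refine (shapeCapacity_le_of_affine hP hΔf hL (by positivity) zero_le_one
    (mutualInfo_shapeOutputLaw_le_log (by lia))).trans (ENNReal.ofReal_le_ofReal ?_)
  calc Δf * (B * (L * Real.log (16 * N)) / L + 1 * P)
      = Δf * (B * Real.log (16 * N) + 1 * P) := by
        field_simp
    _ ≤ Δf * (B * (2 * Real.log N) + (B * Real.log N) * P) := by gcongr
    _ = Δf * (2 + P) * (B * Real.log N) := by ring

end Capacity

section Asymptotics

variable {F : ℕ → ℝ≥0∞} {f : ℕ → ℕ} {s t : ℝ}

lemma eventually_one_le_log : ∀ᶠ N : ℕ in atTop, 1 ≤ Real.log N :=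
  (Real.tendsto_log_atTop.comp tendsto_natCast_atTop_atTop).eventually_ge_atTop 1

lemma HasExponent.exponentAtMost (hf : HasExponent f s) :
    ExponentAtMost (fun N => (f N : ℝ≥0∞)) s := by
  intro δ hδ
  filter_upwards [hf.eventually_lt_const (lt_add_of_pos_right s hδ), eventually_one_le_log,
    eventually_gt_atTop 0] with N hN hlog hpos
  have hN0 : (0 : ℝ) < N := by exact_mod_cast hpos
  rw [div_lt_iff₀ (by linarith)] at hN
  rw [← ENNReal.ofReal_natCast, Real.rpow_def_of_pos hN0, mul_comm]
  refine ENNReal.ofReal_le_ofReal ((Real.le_exp_log _).trans ?_)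
  gcongr

lemma ExponentAtMost.atMostOrder (hF : ExponentAtMost F s) (hst : s < t) :
    AtMostOrder F fun N => (N : ℝ) ^ t := by
  refine ⟨1, ?_⟩
  simpa only [one_mul, add_sub_cancel] using hF (t - s) (sub_pos.2 hst)

lemma atMostOrder_of_isBigO
    (hf : (fun N => (f N : ℝ)) =O[atTop] fun N : ℕ => (N : ℝ) ^ s) :
    AtMostOrder (fun N => (f N : ℝ≥0∞)) fun N => (N : ℝ) ^ s := by
  obtain ⟨C, hC⟩ := hf.bound
  refine ⟨C, hC.mono fun N hN => ?_⟩
  rw [Real.norm_of_nonneg (by positivity), Real.norm_of_nonneg (by positivity)] at hN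
  exact (ENNReal.ofReal_natCast (f N)).symm.trans_le (ENNReal.ofReal_le_ofReal hN)

lemma AtMostOrder.mono {g h : ℕ → ℝ} (hF : AtMostOrder F g)
    (hgh : ∀ᶠ N in atTop, 0 ≤ g N ∧ g N ≤ h N) : AtMostOrder F h := by
  obtain ⟨C, hC⟩ := hF
  refine ⟨|C|, ?_⟩
  filter_upwards [hC, hgh] with N hN hghN
  refine hN.trans (ENNReal.ofReal_le_ofReal ?_)
  exact mul_le_mul (le_abs_self C) hghN.2 hghN.1 (abs_nonneg C)

lemma AtMostOrder.mul_log (hF : AtMostOrder F fun N => (N : ℝ) ^ s) :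
    AtMostOrder F fun N => (N : ℝ) ^ s * Real.log N := by
  refine hF.mono (eventually_one_le_log.mono fun N hlog => ⟨by positivity, ?_⟩)
  exact le_mul_of_one_le_right (by positivity) hlog

lemma AtMostOrder.mono_exponent (hF : AtMostOrder F fun N => (N : ℝ) ^ s) (hst : s ≤ t) :
    AtMostOrder F fun N => (N : ℝ) ^ t := by
  refine hF.mono ((eventually_ge_atTop 1).mono fun N hN => ⟨by positivity, ?_⟩)
  exact Real.rpow_le_rpow_of_exponent_le (by exact_mod_cast hN) hst

lemma exponentAtMost_of_forall_atMostOrder_mul_log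
    (hF : ∀ t, s < t → AtMostOrder F fun N => (N : ℝ) ^ t * Real.log N) : ExponentAtMost F s := by
  intro δ hδ
  obtain ⟨C, hC⟩ := hF (s + δ / 2) (by linarith)
  have hlog : (fun N : ℕ => C * Real.log N) =o[atTop] fun N : ℕ => (N : ℝ) ^ (δ / 2) :=
    ((isLittleO_log_rpow_atTop (half_pos hδ)).comp_tendsto
      tendsto_natCast_atTop_atTop).const_mul_left C
  filter_upwards [hC, hlog.bound one_pos, eventually_gt_atTop 0] with N hN hlogN hpos
  have hN0 : (0 : ℝ) < N := by exact_mod_cast hpos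
  rw [one_mul, Real.norm_of_nonneg (Real.rpow_nonneg hN0.le _)] at hlogN
  refine hN.trans (ENNReal.ofReal_le_ofReal ?_)
  calc C * ((N : ℝ) ^ (s + δ / 2) * Real.log N) = (N : ℝ) ^ (s + δ / 2) * (C * Real.log N) := by
        ring
    _ ≤ (N : ℝ) ^ (s + δ / 2) * (N : ℝ) ^ (δ / 2) := by
        gcongr
        exact (le_abs_self _).trans hlogN
    _ = (N : ℝ) ^ (s + δ) := by
        rw [← Real.rpow_add hN0, add_assoc, add_halves]

end Asymptotics

section CapacityScaling

variable {P Δf : ℝ} {B L : ℕ → ℕ} {ε τ : ℝ}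

lemma atMostOrder_shapeCapacity_one (hP : 0 ≤ P) (hΔf : 0 ≤ Δf) (hL : ∀ N, 0 < L N) :
    AtMostOrder (fun N => shapeCapacity P Δf (B N) N (L N)) fun N => (N : ℝ) ^ (1 : ℝ) := by
  simp only [Real.rpow_one]
  exact ⟨Δf * P, Eventually.of_forall fun N => shapeCapacity_le_linear hP hΔf (hL N)⟩

lemma atMostOrder_shapeCapacity_of_bandwidth (hP : 0 ≤ P) (hΔf : 0 ≤ Δf) (hB : ∀ N, 0 < B N)
    (hL : ∀ N, 0 < L N) (hBε : AtMostOrder (fun N => (B N : ℝ≥0∞)) fun N => (N : ℝ) ^ ε) :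
    AtMostOrder (fun N => shapeCapacity P Δf (B N) N (L N))
      fun N => (N : ℝ) ^ ε * Real.log N := by
  obtain ⟨C, hC⟩ := hBε
  refine ⟨Δf * (2 + P) * C, ?_⟩
  filter_upwards [hC, eventually_ge_atTop 16] with N hN hN16
  have hBN : (B N : ℝ) ≤ C * (N : ℝ) ^ ε := (ENNReal.natCast_le_ofReal (hB N).ne').1 hN
  refine (shapeCapacity_le_log hP hΔf (hB N) (hL N) hN16).trans (ENNReal.ofReal_le_ofReal ?_)
  calc Δf * (2 + P) * (B N * Real.log N)
      ≤ Δf * (2 + P) * (C * (N : ℝ) ^ ε * Real.log N) := by gcongr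
    _ = Δf * (2 + P) * C * ((N : ℝ) ^ ε * Real.log N) := by ring

lemma atMostOrder_shapeCapacity_of_coherence (hP : 0 ≤ P) (hΔf : 0 ≤ Δf) (hL : ∀ N, 0 < L N)
    (hLτ : AtMostOrder (fun N => (L N : ℝ≥0∞)) fun N => (N : ℝ) ^ τ) :
    AtMostOrder (fun N => shapeCapacity P Δf (B N) N (L N))
      fun N => (N : ℝ) ^ ((1 + τ) / 2) := by
  obtain ⟨C, hC⟩ := hLτ
  refine ⟨Δf * P * (8 * Real.sqrt C), ?_⟩
  filter_upwards [hC, eventually_gt_atTop 0] with N hN hpos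
  have hN0 : (0 : ℝ) < N := by exact_mod_cast hpos
  have hLN : (L N : ℝ) ≤ C * (N : ℝ) ^ τ := (ENNReal.natCast_le_ofReal (hL N).ne').1 hN
  have hsqrt : Real.sqrt (N * L N) ≤ Real.sqrt C * (N : ℝ) ^ ((1 + τ) / 2) := by
    calc Real.sqrt (N * L N) ≤ Real.sqrt (N * (C * (N : ℝ) ^ τ)) := by gcongr
      _ = Real.sqrt ((N : ℝ) ^ (1 + τ) * C) := by
          rw [Real.rpow_add hN0, Real.rpow_one]
          ring_nf
      _ = Real.sqrt C * (N : ℝ) ^ ((1 + τ) / 2) := by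
          rw [Real.sqrt_mul (by positivity), Real.sqrt_eq_rpow ((N : ℝ) ^ (1 + τ)),
            ← Real.rpow_mul hN0.le, mul_comm, mul_one_div]
  refine (shapeCapacity_le_sqrt hP hΔf (hL N) hpos).trans (ENNReal.ofReal_le_ofReal ?_)
  rw [mul_assoc (Δf * P), mul_assoc 8]
  gcongr

lemma atMostOrder_shapeCapacity (hP : 0 ≤ P) (hΔf : 0 ≤ Δf) (hL : ∀ N, 0 < L N)
    (hLτ : AtMostOrder (fun N => (L N : ℝ≥0∞)) fun N => (N : ℝ) ^ τ) :
    AtMostOrder (fun N => shapeCapacity P Δf (B N) N (L N))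
      fun N => (N : ℝ) ^ min ((1 + τ) / 2) 1 := by
  rcases min_choice ((1 + τ) / 2) 1 with hmin | hmin <;> rw [hmin]
  · exact atMostOrder_shapeCapacity_of_coherence hP hΔf hL hLτ
  · exact atMostOrder_shapeCapacity_one hP hΔf hL

lemma atMostOrder_shapeCapacity_mul_log (hP : 0 ≤ P) (hΔf : 0 ≤ Δf) (hB : ∀ N, 0 < B N)
    (hL : ∀ N, 0 < L N) (hBε : AtMostOrder (fun N => (B N : ℝ≥0∞)) fun N => (N : ℝ) ^ ε)
    (hLτ : AtMostOrder (fun N => (L N : ℝ≥0∞)) fun N => (N : ℝ) ^ τ) :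
    AtMostOrder (fun N => shapeCapacity P Δf (B N) N (L N))
      fun N => (N : ℝ) ^ min ε (min ((1 + τ) / 2) 1) * Real.log N := by
  rcases min_choice ε (min ((1 + τ) / 2) 1) with hmin | hmin <;> rw [hmin]
  · exact atMostOrder_shapeCapacity_of_bandwidth hP hΔf hB hL hBε
  · exact (atMostOrder_shapeCapacity hP hΔf hL hLτ).mul_log

lemma exponentAtMost_shapeCapacity (hP : 0 ≤ P) (hΔf : 0 ≤ Δf) (hB : ∀ N, 0 < B N)
    (hL : ∀ N, 0 < L N) (hBε : ExponentAtMost (fun N => (B N : ℝ≥0∞)) ε)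
    (hLτ : ExponentAtMost (fun N => (L N : ℝ≥0∞)) τ) :
    ExponentAtMost (fun N => shapeCapacity P Δf (B N) N (L N))
      (min ε (min ((1 + τ) / 2) 1)) := by
  refine exponentAtMost_of_forall_atMostOrder_mul_log fun t ht => ?_
  rcases min_lt_iff.1 ht with hεt | ht
  · exact atMostOrder_shapeCapacity_of_bandwidth hP hΔf hB hL (hBε.atMostOrder hεt)
  · have hτ : τ < τ + 2 * (t - min ((1 + τ) / 2) 1) := by linarith
    refine ((atMostOrder_shapeCapacity hP hΔf hL (hLτ.atMostOrder hτ)).mono_exponent ?_).mul_log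
    grind

end CapacityScaling

end ShapeEncoding

end

theorem mainTheorem3_general (P Δf : ℝ) (hP : 0 ≤ P) (hΔf : 0 ≤ Δf) (ε τ : ℝ)
    (B L : ℕ → ℕ) (hB : ∀ N, 0 < B N) (hL : ∀ N, 0 < L N) :
    (ShapeEncoding.ExponentAtMost (fun N => (B N : ℝ≥0∞)) ε →
      ShapeEncoding.ExponentAtMost (fun N => (L N : ℝ≥0∞)) τ →
      ShapeEncoding.ExponentAtMost
        (fun N => ShapeEncoding.shapeCapacity P Δf (B N) N (L N))
        (min ε (min ((1 + τ) / 2) 1))) ∧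
    (ShapeEncoding.AtMostOrder (fun N => (B N : ℝ≥0∞)) (fun N => (N : ℝ) ^ ε) →
      ShapeEncoding.AtMostOrder (fun N => (L N : ℝ≥0∞)) (fun N => (N : ℝ) ^ τ) →
      ShapeEncoding.AtMostOrder
        (fun N => ShapeEncoding.shapeCapacity P Δf (B N) N (L N))
        (fun N => (N : ℝ) ^ (min ε (min ((1 + τ) / 2) 1)) * Real.log N) ∧
      (min ((1 + τ) / 2) 1 ≤ ε →
        ShapeEncoding.AtMostOrder
          (fun N => ShapeEncoding.shapeCapacity P Δf (B N) N (L N))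
          (fun N => (N : ℝ) ^ (min ε (min ((1 + τ) / 2) 1))))) :=
  ⟨ShapeEncoding.exponentAtMost_shapeCapacity hP hΔf hB hL, fun hBε hLτ =>
    ⟨ShapeEncoding.atMostOrder_shapeCapacity_mul_log hP hΔf hB hL hBε hLτ, fun hle => by
      simpa only [min_eq_right hle] using ShapeEncoding.atMostOrder_shapeCapacity hP hΔf hL hLτ⟩⟩

theorem mainTheorem3 (P Δf : ℝ) (hP : 0 < P) (hΔf : 0 < Δf)
    (ε τ : ℝ) (hε : 0 ≤ ε) (hτ : 0 ≤ τ)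
    (B L : ℕ → ℕ) (hB : ∀ N, 0 < B N) (hL : ∀ N, 0 < L N) :
    (ShapeEncoding.HasExponent B ε → ShapeEncoding.HasExponent L τ →
      ShapeEncoding.ExponentAtMost
        (fun N => ShapeEncoding.shapeCapacity P Δf (B N) N (L N))
        (min ε (min ((1 + τ) / 2) 1))) ∧
    ((fun N : ℕ => (B N : ℝ)) =Θ[atTop] (fun N : ℕ => (N : ℝ) ^ ε) →
      (fun N : ℕ => (L N : ℝ)) =Θ[atTop] (fun N : ℕ => (N : ℝ) ^ τ) →
      ShapeEncoding.AtMostOrder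
        (fun N => ShapeEncoding.shapeCapacity P Δf (B N) N (L N))
        (fun N => (N : ℝ) ^ (min ε (min ((1 + τ) / 2) 1)) * Real.log N) ∧
      (min ((1 + τ) / 2) 1 ≤ ε →
        ShapeEncoding.AtMostOrder
          (fun N => ShapeEncoding.shapeCapacity P Δf (B N) N (L N))
          (fun N => (N : ℝ) ^ (min ε (min ((1 + τ) / 2) 1))))) :=
  have h := mainTheorem3_general P Δf hP.le hΔf.le ε τ B L hB hL
  ⟨fun hBε hLτ => h.1 hBε.exponentAtMost hLτ.exponentAtMost, fun hBε hLτ =>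
    h.2 (ShapeEncoding.atMostOrder_of_isBigO hBε.1) (ShapeEncoding.atMostOrder_of_isBigO hLτ.1)⟩
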